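/- Let $\Bbbk$ be a field. Let $\mathrm{noncom\text{-}Zin}$ (the nonsymmetric Zinbiel operad, which is the dendriform operad up to renaming the two operations) be the nonsymmetric $\Bbbk$-linear operad generated by two binary operations $\prec,\succ$ subject to the relations \[ (x_1\succ x_2)\succ x_3=x_1\succ(x_2\succ x_3)+x_1\succ(x_2\prec x_3), \] \[ (x_1\prec x_2)\succ x_3=x_1\prec(x_2\succ x_3), \] \[ x_1\prec(x_2\prec x_3)=(x_1\succ x_2)\prec x_3+(x_1\prec x_2)\prec x_3, \] that is, the quotient of the free nonsymmetric operad on $\prec,\succ$ by the operadic ideal generated by these relations. Then for every $n\ge 1$ the component $\mathrm{noncom\text{-}Zin}(n)$ of arity $n$ is finite-dimensional, and its dimension is the $n$-th Catalan number: \[ \dim_{\Bbbk}\bigl(\mathrm{noncom\text{-}Zin}(n)\bigr)=C_n=\frac{(2n)!}{n!\,(n+1)!}. \] -/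

import Mathlib

universe u v

/-- A nonsymmetric `𝕜`-linear operad in the partial-composition presentation:
a family of vector spaces `Op n`, a unit in arity one, and bilinear partial compositions
`a ∘ᵢ b` (insertion of `b` into the `i`-th input of `a`, inputs being numbered from `0`),
subject to the unit, sequential and parallel axioms. The arity of the result is carried by an
equation `r + 1 = m + n`, that is, `r = m + n - 1`. -/
structure NSOperad (𝕜 : Type u) [Field 𝕜] where
  Op : ℕ → Type v
  [addCommGroup : ∀ n, AddCommGroup (Op n)]
  [module : ∀ n, Module 𝕜 (Op n)]
  one : Op 1
  comp : ∀ {m n r : ℕ} (i : ℕ) (_ : i < m) (_ : r + 1 = m + n), Op m →ₗ[𝕜] Op n →ₗ[𝕜] Op r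
  one_comp : ∀ {n : ℕ} (hi : 0 < 1) (h : n + 1 = 1 + n) (b : Op n), comp 0 hi h one b = b
  comp_one : ∀ {m : ℕ} (i : ℕ) (hi : i < m) (h : m + 1 = m + 1) (a : Op m),
    comp i hi h a one = a
  /-- `(a ∘ᵢ b) ∘ᵢ₊ⱼ c = a ∘ᵢ (b ∘ⱼ c)` -/
  comp_seq : ∀ {l m n p q s : ℕ} (i j : ℕ) (hi : i < l) (hj : j < m) (hij : i + j < p)
    (hp : p + 1 = l + m) (hq : q + 1 = p + n) (hs : s + 1 = m + n) (hq' : q + 1 = l + s)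
    (a : Op l) (b : Op m) (c : Op n),
    comp (i + j) hij hq (comp i hi hp a b) c = comp i hi hq' a (comp j hj hs b c)
  /-- `(a ∘ᵢ b) ∘ⱼ₊ₘ₋₁ c = (a ∘ⱼ c) ∘ᵢ b` for `i < j`, where `m` is the arity of `b` -/
  comp_par : ∀ {l m n p q s : ℕ} (i j j' : ℕ) (_ : i < j) (hj : j < l) (hi : i < l)
    (_ : j' + 1 = j + m) (hj' : j' < p) (hi' : i < s)
    (hp : p + 1 = l + m) (hq : q + 1 = p + n) (hs : s + 1 = l + n) (hq' : q + 1 = s + m)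
    (a : Op l) (b : Op m) (c : Op n),
    comp j' hj' hq (comp i hi hp a b) c = comp i hi' hq' (comp j hj hs a c) b

attribute [instance] NSOperad.addCommGroup NSOperad.module

namespace NSOperad

variable {𝕜 : Type u} [Field 𝕜]

/-- A (two-sided) operadic ideal: a family of subspaces such that a partial composition lies in
the family as soon as one of its two arguments does. -/
@[ext]
structure OperadIdeal (P : NSOperad.{u, v} 𝕜) where
  carrier : ∀ n, Submodule 𝕜 (P.Op n)
  comp_mem_left : ∀ {m n r : ℕ} (i : ℕ) (hi : i < m) (h : r + 1 = m + n) (a : P.Op m)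
    (b : P.Op n), a ∈ carrier m → P.comp i hi h a b ∈ carrier r
  comp_mem_right : ∀ {m n r : ℕ} (i : ℕ) (hi : i < m) (h : r + 1 = m + n) (a : P.Op m)
    (b : P.Op n), b ∈ carrier n → P.comp i hi h a b ∈ carrier r

/-- The operadic ideal generated by a family of sets of elements: the intersection of all operadic
ideals containing it. -/
def idealSpan (P : NSOperad.{u, v} 𝕜) (R : ∀ n, Set (P.Op n)) : OperadIdeal P where
  carrier n := ⨅ J : {J : OperadIdeal P // ∀ k, R k ⊆ J.carrier k}, J.1.carrier n
  comp_mem_left i hi h a b ha := by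
    simp only [Submodule.mem_iInf] at ha ⊢
    exact fun J => J.1.comp_mem_left i hi h a b (ha J)
  comp_mem_right i hi h a b hb := by
    simp only [Submodule.mem_iInf] at hb ⊢
    exact fun J => J.1.comp_mem_right i hi h a b (hb J)

/-- Partial composition on the quotient by an operadic ideal, induced by that of the operad. -/
def quotientComp (P : NSOperad.{u, v} 𝕜) (I : OperadIdeal P) {m n r : ℕ} (i : ℕ) (hi : i < m)
    (h : r + 1 = m + n) :
    (P.Op m ⧸ I.carrier m) →ₗ[𝕜] (P.Op n ⧸ I.carrier n) →ₗ[𝕜] (P.Op r ⧸ I.carrier r) :=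
  ((I.carrier n).liftQ
    (((I.carrier m).liftQ ((P.comp i hi h).compr₂ (I.carrier r).mkQ) (by
      intro a ha
      rw [LinearMap.mem_ker]
      ext b
      simpa using I.comp_mem_left i hi h a b ha)).flip) (by
      intro b hb
      rw [LinearMap.mem_ker]
      ext a
      simpa using I.comp_mem_right i hi h a b hb)).flip

theorem quotientComp_mk (P : NSOperad.{u, v} 𝕜) (I : OperadIdeal P) {m n r : ℕ} (i : ℕ)
    (hi : i < m) (h : r + 1 = m + n) (a : P.Op m) (b : P.Op n) :
    quotientComp P I i hi h (Submodule.Quotient.mk a) (Submodule.Quotient.mk b) =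
      Submodule.Quotient.mk (P.comp i hi h a b) := rfl

/-- The quotient of a nonsymmetric operad by an operadic ideal. -/
def quotient (P : NSOperad.{u, v} 𝕜) (I : OperadIdeal P) : NSOperad.{u, v} 𝕜 where
  Op n := P.Op n ⧸ I.carrier n
  one := Submodule.Quotient.mk P.one
  comp i hi h := quotientComp P I i hi h
  one_comp hi h b := by
    obtain ⟨b, rfl⟩ := Submodule.Quotient.mk_surjective _ b
    rw [quotientComp_mk, P.one_comp]
  comp_one i hi h a := by
    obtain ⟨a, rfl⟩ := Submodule.Quotient.mk_surjective _ a
    rw [quotientComp_mk, P.comp_one]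
  comp_seq i j hi hj hij hp hq hs hq' a b c := by
    obtain ⟨a, rfl⟩ := Submodule.Quotient.mk_surjective _ a
    obtain ⟨b, rfl⟩ := Submodule.Quotient.mk_surjective _ b
    obtain ⟨c, rfl⟩ := Submodule.Quotient.mk_surjective _ c
    simp only [quotientComp_mk]
    rw [P.comp_seq i j hi hj hij hp hq hs hq']
  comp_par i j j' hij hj hi hjj hj' hi' hp hq hs hq' a b c := by
    obtain ⟨a, rfl⟩ := Submodule.Quotient.mk_surjective _ a
    obtain ⟨b, rfl⟩ := Submodule.Quotient.mk_surjective _ b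
    obtain ⟨c, rfl⟩ := Submodule.Quotient.mk_surjective _ c
    simp only [quotientComp_mk]
    rw [P.comp_par i j j' hij hj hi hjj hj' hi' hp hq hs hq']

end NSOperad

/-- Tree monomials in binary generators labelled by `L`: planar binary trees whose internal
vertices are labelled by elements of `L`. -/
inductive TreeMonomial (L : Type) : Type
  | leaf : TreeMonomial L
  | node (g : L) (left right : TreeMonomial L) : TreeMonomial L

namespace TreeMonomial

variable {L : Type}

/-- The arity of a tree monomial: its number of leaves. -/
def arity : TreeMonomial L → ℕ
  | leaf => 1
  | node _ l r => l.arity + r.arity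

/-- `graft t i s` replaces the `i`-th leaf of `t` (leaves being numbered from left to right,
starting from `0`) by the tree `s`; it is only used for `i < t.arity`. -/
def graft : TreeMonomial L → ℕ → TreeMonomial L → TreeMonomial L
  | leaf, _, s => s
  | node g l r, i, s =>
    if i < l.arity then node g (graft l i s) r else node g l (graft r (i - l.arity) s)

theorem arity_graft (t : TreeMonomial L) (i : ℕ) (s : TreeMonomial L) (hi : i < t.arity) :
    (graft t i s).arity + 1 = t.arity + s.arity := by
  induction t generalizing i with
  | leaf => simp [graft, arity]; omega
  | node g l r ihl ihr =>
    simp only [arity] at hi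
    by_cases h : i < l.arity
    · have := ihl i h
      simp only [graft, h, if_true, arity]; omega
    · have := ihr (i - l.arity) (by omega)
      simp only [graft, h, if_false, arity]; omega

theorem graft_leaf (t : TreeMonomial L) (i : ℕ) (hi : i < t.arity) : graft t i leaf = t := by
  induction t generalizing i with
  | leaf => rfl
  | node g l r ihl ihr =>
    simp only [arity] at hi
    by_cases h : i < l.arity
    · simp [graft, h, ihl i h]
    · simp [graft, h, ihr (i - l.arity) (by omega)]

theorem graft_seq (t s w : TreeMonomial L) (i j : ℕ) (hi : i < t.arity) (hj : j < s.arity) :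
    graft (graft t i s) (i + j) w = graft t i (graft s j w) := by
  induction t generalizing i with
  | leaf =>
    have : i = 0 := by simpa [arity] using hi
    subst this
    simp [graft]
  | node g l r ihl ihr =>
    simp only [arity] at hi
    by_cases h : i < l.arity
    · have h1 := arity_graft l i s h
      have h2 : i + j < (graft l i s).arity := by omega
      simp [graft, h, h2, ihl i h]
    · have h2 : ¬ i + j < l.arity := by omega
      have h3 : i + j - l.arity = (i - l.arity) + j := by omega
      simp [graft, h, h2, h3, ihr (i - l.arity) (by omega)]

theorem graft_par (t s w : TreeMonomial L) (i j j' : ℕ) (hij : i < j) (hj : j < t.arity)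
    (hj' : j' + 1 = j + s.arity) :
    graft (graft t i s) j' w = graft (graft t j w) i s := by
  induction t generalizing i j j' with
  | leaf => simp only [arity] at hj; omega
  | node g l r ihl ihr =>
    simp only [arity] at hj
    by_cases h : j < l.arity
    · have hi : i < l.arity := by omega
      have h1 := arity_graft l i s hi
      have h2 := arity_graft l j w h
      have hw : 0 < w.arity := by
        clear * -
        induction w with
        | leaf => simp [arity]
        | node g l r _ _ => simp only [arity]; omega
      have h3 : j' < (graft l i s).arity := by omega
      have h4 : i < (graft l j w).arity := by omega
      simp [graft, h, hi, h3, h4, ihl i j j' hij h hj']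
    · by_cases hi : i < l.arity
      · have h1 := arity_graft l i s hi
        have h3 : ¬ j' < (graft l i s).arity := by omega
        have h4 : j' - (graft l i s).arity = j - l.arity := by omega
        simp [graft, h, hi, h3, h4]
      · have hs : 0 < s.arity := by
          clear * -
          induction s with
          | leaf => simp [arity]
          | node g l r _ _ => simp only [arity]; omega
        have h3 : ¬ j' < l.arity := by omega
        simp [graft, h, hi, h3,
          ihr (i - l.arity) (j - l.arity) (j' - l.arity) (by omega) (by omega) (by omega)]

/-- The tree monomials of arity `n`. -/
def OfArity (L : Type) (n : ℕ) : Type := {t : TreeMonomial L // t.arity = n}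

/-- The unique tree monomial of arity one. -/
def OfArity.leaf (L : Type) : OfArity L 1 := ⟨TreeMonomial.leaf, rfl⟩

/-- The tree monomial of arity two with root labelled by `g`. -/
def OfArity.corolla {L : Type} (g : L) : OfArity L 2 :=
  ⟨TreeMonomial.node g TreeMonomial.leaf TreeMonomial.leaf, rfl⟩

/-- Grafting of tree monomials of given arities. -/
def OfArity.graft {m n r : ℕ} (i : ℕ) (hi : i < m) (h : r + 1 = m + n)
    (t : OfArity L m) (s : OfArity L n) : OfArity L r :=
  ⟨TreeMonomial.graft t.1 i s.1, by
    have h1 := arity_graft t.1 i s.1 (by rw [t.2]; exact hi)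
    rw [t.2, s.2] at h1
    omega⟩

end TreeMonomial

namespace NSOperad

variable (𝕜 : Type u) [Field 𝕜] (L : Type)

/-- Bilinear extension of grafting to linear combinations of tree monomials. -/
noncomputable def freeComp {m n r : ℕ} (i : ℕ) (hi : i < m) (h : r + 1 = m + n) :
    (TreeMonomial.OfArity L m →₀ 𝕜) →ₗ[𝕜] (TreeMonomial.OfArity L n →₀ 𝕜) →ₗ[𝕜]
      (TreeMonomial.OfArity L r →₀ 𝕜) :=
  Finsupp.linearCombination 𝕜 fun t =>
    Finsupp.linearCombination 𝕜 fun s =>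
      Finsupp.single (TreeMonomial.OfArity.graft i hi h t s) (1 : 𝕜)

theorem freeComp_single {m n r : ℕ} (i : ℕ) (hi : i < m) (h : r + 1 = m + n)
    (t : TreeMonomial.OfArity L m) (s : TreeMonomial.OfArity L n) (x y : 𝕜) :
    freeComp 𝕜 L i hi h (Finsupp.single t x) (Finsupp.single s y) =
      Finsupp.single (TreeMonomial.OfArity.graft i hi h t s) (x * y) := by
  simp [freeComp]

/-- The free nonsymmetric operad generated by a set `L` of binary operations: its arity `n`
component has the tree monomials of arity `n` as a basis, and the partial compositions are
given by grafting. -/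
noncomputable def free : NSOperad.{u, u} 𝕜 where
  Op n := TreeMonomial.OfArity L n →₀ 𝕜
  one := Finsupp.single (TreeMonomial.OfArity.leaf L) 1
  comp i hi h := freeComp 𝕜 L i hi h
  one_comp hi h b := by
    induction b using Finsupp.induction_linear with
    | zero => simp
    | add f g hf hg => rw [map_add, hf, hg]
    | single s y =>
      rw [freeComp_single, one_mul]
      rfl
  comp_one i hi h a := by
    induction a using Finsupp.induction_linear with
    | zero => simp
    | add f g hf hg => rw [map_add, LinearMap.add_apply, hf, hg]
    | single t x =>
      rw [freeComp_single, mul_one]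
      congr 1
      exact Subtype.ext (TreeMonomial.graft_leaf t.1 i (by rw [t.2]; exact hi))
  comp_seq i j hi hj hij hp hq hs hq' a b c := by
    induction a using Finsupp.induction_linear with
    | zero => simp
    | add f g hf hg => simp only [map_add, LinearMap.add_apply, hf, hg]
    | single t x =>
    induction b using Finsupp.induction_linear with
    | zero => simp
    | add f g hf hg => simp only [map_add, LinearMap.add_apply, hf, hg]
    | single s y =>
    induction c using Finsupp.induction_linear with
    | zero => simp
    | add f g hf hg => simp only [map_add, hf, hg]
    | single w z =>
      simp only [freeComp_single, mul_assoc]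
      congr 1
      exact Subtype.ext (TreeMonomial.graft_seq t.1 s.1 w.1 i j (by rw [t.2]; exact hi)
        (by rw [s.2]; exact hj))
  comp_par i j j' hij hj hi hjj hj' hi' hp hq hs hq' a b c := by
    induction a using Finsupp.induction_linear with
    | zero => simp
    | add f g hf hg => simp only [map_add, LinearMap.add_apply, hf, hg]
    | single t x =>
    induction b using Finsupp.induction_linear with
    | zero => simp
    | add f g hf hg => simp only [map_add, LinearMap.add_apply, hf, hg]
    | single s y =>
    induction c using Finsupp.induction_linear with
    | zero => simp
    | add f g hf hg => simp only [map_add, LinearMap.add_apply, hf, hg]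
    | single w z =>
      simp only [freeComp_single, mul_right_comm x y z]
      congr 1
      exact Subtype.ext (TreeMonomial.graft_par t.1 s.1 w.1 i j j' hij (by rw [t.2]; exact hj)
        (by rw [s.2]; exact hjj))

/-- The binary generator `x₁ g x₂` of the free operad. -/
noncomputable def free.gen (g : L) : (free 𝕜 L).Op 2 :=
  Finsupp.single (TreeMonomial.OfArity.corolla g) (1 : 𝕜)

variable {L}

/-- The arity-three element `(x₁ g x₂) f x₃` of the free operad. -/
noncomputable def free.leftComb (f g : L) : (free 𝕜 L).Op 3 :=
  (free 𝕜 L).comp 0 (by norm_num) (by norm_num) (free.gen 𝕜 L f) (free.gen 𝕜 L g)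

/-- The arity-three element `x₁ f (x₂ g x₃)` of the free operad. -/
noncomputable def free.rightComb (f g : L) : (free 𝕜 L).Op 3 :=
  (free 𝕜 L).comp 1 (by norm_num) (by norm_num) (free.gen 𝕜 L f) (free.gen 𝕜 L g)

end NSOperad

/-- The two binary operations of the nonsymmetric Zinbiel operad: `≺` and `≻`. -/
inductive ZinGen : Type
  | prec : ZinGen
  | succ : ZinGen

open NSOperad in
/-- The defining relations, all of arity three:
`(x₁ ≻ x₂) ≻ x₃ = x₁ ≻ (x₂ ≻ x₃) + x₁ ≻ (x₂ ≺ x₃)`,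
`(x₁ ≺ x₂) ≻ x₃ = x₁ ≺ (x₂ ≻ x₃)`,
`x₁ ≺ (x₂ ≺ x₃) = (x₁ ≻ x₂) ≺ x₃ + (x₁ ≺ x₂) ≺ x₃`. -/
def zinRelations (𝕜 : Type u) [Field 𝕜] : ∀ n, Set ((free 𝕜 ZinGen).Op n)
  | 3 => {free.leftComb 𝕜 ZinGen.succ ZinGen.succ
            - free.rightComb 𝕜 ZinGen.succ ZinGen.succ
            - free.rightComb 𝕜 ZinGen.succ ZinGen.prec,
          free.leftComb 𝕜 ZinGen.succ ZinGen.prec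
            - free.rightComb 𝕜 ZinGen.prec ZinGen.succ,
          free.rightComb 𝕜 ZinGen.prec ZinGen.prec
            - free.leftComb 𝕜 ZinGen.prec ZinGen.succ
            - free.leftComb 𝕜 ZinGen.prec ZinGen.prec}
  | _ => ∅

/-- The nonsymmetric Zinbiel operad over `𝕜`: the quotient of the free nonsymmetric operad on two
binary operations `≺`, `≻` by the operadic ideal generated by the defining relations. -/
noncomputable def noncomZin (𝕜 : Type u) [Field 𝕜] : NSOperad.{u, u} 𝕜 :=
  (NSOperad.free 𝕜 ZinGen).quotient
    ((NSOperad.free 𝕜 ZinGen).idealSpan (zinRelations 𝕜))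

/-! The dimension is found by exhibiting a basis indexed by planar binary trees with `n` internal
nodes, which are counted by the Catalan number. A nonempty tree with subtrees `l`, `r` is assigned
the monomial `(l ≺ x) ≻ r`, an empty factor being omitted, with one leaf per node.

Spanning: read in a suitable direction, the three relations rewrite any product of two normal forms
into a combination of normal forms (`zinClass_node_normalForm_mem`); induction on tree monomials
does the rest.

Independence: the span of planar binary trees is an algebra over the operad, with the Loday–Ronco
product `*` split according to which factor supplies the root: `≻` keeps the root of the left
factor, `≺` that of the right one (`isNoncomZinbiel_op`). The identities of any algebra form an
operadic ideal, so evaluation descends to the quotient operad. With every input equal to the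
one-node tree, the normal form of `T` evaluates to `T` itself (`eval_normalForm`), and distinct
trees are independent. -/

/-- Bilinear extension of a map defined on pairs of basis elements. -/
noncomputable def Finsupp.bilinearExtend (𝕜 : Type u) [Field 𝕜] {X Y : Type} {M : Type v}
    [AddCommGroup M] [Module 𝕜 M] (f : X → Y → M) : (X →₀ 𝕜) →ₗ[𝕜] (Y →₀ 𝕜) →ₗ[𝕜] M :=
  Finsupp.linearCombination 𝕜 fun x => Finsupp.linearCombination 𝕜 (f x)

@[simp]
theorem Finsupp.bilinearExtend_single (𝕜 : Type u) [Field 𝕜] {X Y : Type} {M : Type v}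
    [AddCommGroup M] [Module 𝕜 M] (f : X → Y → M) (x : X) (y : Y) :
    Finsupp.bilinearExtend 𝕜 f (Finsupp.single x 1) (Finsupp.single y 1) = f x y := by
  simp [Finsupp.bilinearExtend]

/-- A vector space with two bilinear operations indexed by `ZinGen` satisfies the nonsymmetric
Zinbiel relations. -/
structure IsNoncomZinbiel {𝕜 : Type u} [Field 𝕜] {A : Type v} [AddCommGroup A] [Module 𝕜 A]
    (op : ZinGen → A →ₗ[𝕜] A →ₗ[𝕜] A) : Prop where
  succ_succ : ∀ x y z, op .succ (op .succ x y) z = op .succ x (op .succ y z + op .prec y z)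
  prec_succ : ∀ x y z, op .succ (op .prec x y) z = op .prec x (op .succ y z)
  prec_prec : ∀ x y z, op .prec x (op .prec y z) = op .prec (op .succ x y + op .prec x y) z

/-! ### The Loday–Ronco algebra of planar binary trees -/

namespace LodayRonco

open BinaryTree Finsupp

variable (𝕜 : Type u) [Field 𝕜]

/-- Joining two planar binary trees at a new root, extended bilinearly. -/
noncomputable def join :
    (BinaryTree Unit →₀ 𝕜) →ₗ[𝕜] (BinaryTree Unit →₀ 𝕜) →ₗ[𝕜] (BinaryTree Unit →₀ 𝕜) :=
  bilinearExtend 𝕜 fun a b => single (node () a b) 1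

/-- The product of two planar binary trees. -/
noncomputable def starTree : BinaryTree Unit → BinaryTree Unit → (BinaryTree Unit →₀ 𝕜)
  | nil, y => single y 1
  | x, nil => single x 1
  -- The first summand has the root of the left factor, the second that of the right factor.
  | node _ a b, node _ c d =>
    join 𝕜 (single a 1) (starTree b (node () c d)) + join 𝕜 (starTree (node () a b) c) (single d 1)
termination_by x y => x.numNodes + y.numNodes
decreasing_by all_goals simp only [numNodes]; omega

/-- The associative product on the span of planar binary trees. -/
noncomputable def star :
    (BinaryTree Unit →₀ 𝕜) →ₗ[𝕜] (BinaryTree Unit →₀ 𝕜) →ₗ[𝕜] (BinaryTree Unit →₀ 𝕜) :=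
  bilinearExtend 𝕜 (starTree 𝕜)

/-- The two halves of the product on nonempty trees, extended by zero to the empty tree. -/
noncomputable def opTree : ZinGen → BinaryTree Unit → BinaryTree Unit → (BinaryTree Unit →₀ 𝕜)
  | _, nil, _ => 0
  | _, _, nil => 0
  | .succ, node _ a b, node _ c d => join 𝕜 (single a 1) (starTree 𝕜 b (node () c d))
  | .prec, node _ a b, node _ c d => join 𝕜 (starTree 𝕜 (node () a b) c) (single d 1)

/-- The two operations on the span of planar binary trees. -/
noncomputable def op (g : ZinGen) :
    (BinaryTree Unit →₀ 𝕜) →ₗ[𝕜] (BinaryTree Unit →₀ 𝕜) →ₗ[𝕜] (BinaryTree Unit →₀ 𝕜) :=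
  bilinearExtend 𝕜 (opTree 𝕜 g)

@[simp]
theorem join_single (a b : BinaryTree Unit) :
    join 𝕜 (single a 1) (single b 1) = single (node () a b) 1 := by
  simp [join]

theorem star_single (x y : BinaryTree Unit) :
    star 𝕜 (single x 1) (single y 1) = starTree 𝕜 x y := by
  simp [star]

@[simp]
theorem nil_star (f : BinaryTree Unit →₀ 𝕜) : star 𝕜 (single nil 1) f = f := by
  suffices h : star 𝕜 (single nil 1) = LinearMap.id by rw [h]; rfl
  ext y : 3
  simp [star_single, starTree]

@[simp]
theorem star_nil (f : BinaryTree Unit →₀ 𝕜) : star 𝕜 f (single nil 1) = f := by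
  suffices h : (star 𝕜).flip (single nil 1) = LinearMap.id by
    rw [← LinearMap.flip_apply, h]; rfl
  ext y : 3
  cases y <;> simp [star_single, starTree]

@[simp]
theorem op_nil_left (g : ZinGen) (f : BinaryTree Unit →₀ 𝕜) : op 𝕜 g (single nil 1) f = 0 := by
  suffices h : op 𝕜 g (single nil 1) = 0 by rw [h]; rfl
  ext y : 3
  simp [op, opTree]

@[simp]
theorem op_nil_right (g : ZinGen) (f : BinaryTree Unit →₀ 𝕜) : op 𝕜 g f (single nil 1) = 0 := by
  suffices h : (op 𝕜 g).flip (single nil 1) = 0 by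
    rw [← LinearMap.flip_apply, h]; rfl
  ext y : 3
  cases y <;> simp [op, opTree]

theorem star_node_node (a b c d : BinaryTree Unit) :
    star 𝕜 (single (node () a b) 1) (single (node () c d) 1) =
      op 𝕜 .succ (single (node () a b) 1) (single (node () c d) 1) +
      op 𝕜 .prec (single (node () a b) 1) (single (node () c d) 1) := by
  simp [star_single, op, opTree, starTree]

/-- The recursive formula is bilinear in the two subtrees, so it extends from trees to combinations.
The other factor must be a nonempty tree, since `op` vanishes on `nil` whereas `nil` is a unit for
`star`. The companion lemmas below follow the same pattern. -/
theorem op_succ_join_left (f g : BinaryTree Unit →₀ 𝕜) (c d : BinaryTree Unit) :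
    op 𝕜 .succ (join 𝕜 f g) (single (node () c d) 1) =
      join 𝕜 f (star 𝕜 g (single (node () c d) 1)) := by
  suffices h : (join 𝕜).compr₂ ((op 𝕜 .succ).flip (single (node () c d) 1)) =
      (join 𝕜).compl₂ ((star 𝕜).flip (single (node () c d) 1)) from
    LinearMap.congr_fun₂ h f g
  ext a b : 6
  simp [op, opTree, star_single]

theorem op_prec_join_left (f g : BinaryTree Unit →₀ 𝕜) (c d : BinaryTree Unit) :
    op 𝕜 .prec (join 𝕜 f g) (single (node () c d) 1) =
      join 𝕜 (star 𝕜 (join 𝕜 f g) (single c 1)) (single d 1) := by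
  suffices h : (join 𝕜).compr₂ ((op 𝕜 .prec).flip (single (node () c d) 1)) =
      (join 𝕜).compr₂ ((join 𝕜).flip (single d 1) ∘ₗ (star 𝕜).flip (single c 1)) from
    LinearMap.congr_fun₂ h f g
  ext a b : 6
  simp [op, opTree, star_single]

theorem op_succ_join_right (f g : BinaryTree Unit →₀ 𝕜) (a b : BinaryTree Unit) :
    op 𝕜 .succ (single (node () a b) 1) (join 𝕜 f g) =
      join 𝕜 (single a 1) (star 𝕜 (single b 1) (join 𝕜 f g)) := by
  suffices h : (join 𝕜).compr₂ (op 𝕜 .succ (single (node () a b) 1)) =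
      (join 𝕜).compr₂ (join 𝕜 (single a 1) ∘ₗ star 𝕜 (single b 1)) from
    LinearMap.congr_fun₂ h f g
  ext c d : 6
  simp [op, opTree, star_single]

theorem op_prec_join_right (f g : BinaryTree Unit →₀ 𝕜) (a b : BinaryTree Unit) :
    op 𝕜 .prec (single (node () a b) 1) (join 𝕜 f g) =
      join 𝕜 (star 𝕜 (single (node () a b) 1) f) g := by
  suffices h : (join 𝕜).compr₂ (op 𝕜 .prec (single (node () a b) 1)) =
      (join 𝕜) ∘ₗ (star 𝕜 (single (node () a b) 1)) from
    LinearMap.congr_fun₂ h f g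
  ext c d : 6
  simp [op, opTree, star_single]

theorem star_join_left (f g : BinaryTree Unit →₀ 𝕜) (c d : BinaryTree Unit) :
    star 𝕜 (join 𝕜 f g) (single (node () c d) 1) =
      op 𝕜 .succ (join 𝕜 f g) (single (node () c d) 1) +
      op 𝕜 .prec (join 𝕜 f g) (single (node () c d) 1) := by
  suffices h : (join 𝕜).compr₂ ((star 𝕜).flip (single (node () c d) 1)) =
      (join 𝕜).compr₂ ((op 𝕜 .succ).flip (single (node () c d) 1)) +
      (join 𝕜).compr₂ ((op 𝕜 .prec).flip (single (node () c d) 1)) from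
    LinearMap.congr_fun₂ h f g
  ext a b : 6
  simp [star_node_node]

theorem star_join_right (f g : BinaryTree Unit →₀ 𝕜) (a b : BinaryTree Unit) :
    star 𝕜 (single (node () a b) 1) (join 𝕜 f g) =
      op 𝕜 .succ (single (node () a b) 1) (join 𝕜 f g) +
      op 𝕜 .prec (single (node () a b) 1) (join 𝕜 f g) := by
  suffices h : (join 𝕜).compr₂ (star 𝕜 (single (node () a b) 1)) =
      (join 𝕜).compr₂ (op 𝕜 .succ (single (node () a b) 1)) +
      (join 𝕜).compr₂ (op 𝕜 .prec (single (node () a b) 1)) from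
    LinearMap.congr_fun₂ h f g
  ext c d : 6
  simp [star_node_node]

theorem op_succ_node_node (a b c d : BinaryTree Unit) :
    op 𝕜 .succ (single (node () a b) 1) (single (node () c d) 1) =
      join 𝕜 (single a 1) (star 𝕜 (single b 1) (single (node () c d) 1)) := by
  simp [op, opTree, star_single]

theorem op_prec_node_node (a b c d : BinaryTree Unit) :
    op 𝕜 .prec (single (node () a b) 1) (single (node () c d) 1) =
      join 𝕜 (star 𝕜 (single (node () a b) 1) (single c 1)) (single d 1) := by
  simp [op, opTree, star_single]

/-- For nonempty trees either bracketing splits into three summands, according to which factor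
supplies the root. The middle summands agree on the nose; the outer two agree by induction on the
total number of nodes. -/
theorem star_assoc_single (x y z : BinaryTree Unit) :
    star 𝕜 (star 𝕜 (single x 1) (single y 1)) (single z 1) =
      star 𝕜 (single x 1) (star 𝕜 (single y 1) (single z 1)) := by
  match x, y, z with
  | nil, _, _ => simp
  | node _ _ _, nil, _ => simp
  | node _ _ _, node _ _ _, nil => simp
  | node _ a b, node _ c d, node _ e f =>
    have h1 := star_assoc_single b (node () c d) (node () e f)
    have h2 := star_assoc_single (node () a b) (node () c d) e
    have hyz := star_node_node 𝕜 c d e f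
    have hxy := star_node_node 𝕜 a b c d
    have hl : star 𝕜 (star 𝕜 (single (node () a b) 1) (single (node () c d) 1))
        (single (node () e f) 1) =
        join 𝕜 (single a 1)
          (star 𝕜 (star 𝕜 (single b 1) (single (node () c d) 1)) (single (node () e f) 1)) +
        join 𝕜 (star 𝕜 (single (node () a b) 1) (single c 1))
          (star 𝕜 (single d 1) (single (node () e f) 1)) +
        join 𝕜 (star 𝕜 (star 𝕜 (single (node () a b) 1) (single (node () c d) 1)) (single e 1))
          (single f 1) := by
      rw [hxy, op_succ_node_node, op_prec_node_node]
      simp only [map_add, LinearMap.add_apply, star_join_left, op_succ_join_left,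
        op_prec_join_left]
      abel
    have hr : star 𝕜 (single (node () a b) 1)
        (star 𝕜 (single (node () c d) 1) (single (node () e f) 1)) =
        join 𝕜 (single a 1)
          (star 𝕜 (single b 1) (star 𝕜 (single (node () c d) 1) (single (node () e f) 1))) +
        join 𝕜 (star 𝕜 (single (node () a b) 1) (single c 1))
          (star 𝕜 (single d 1) (single (node () e f) 1)) +
        join 𝕜 (star 𝕜 (single (node () a b) 1) (star 𝕜 (single (node () c d) 1) (single e 1)))
          (single f 1) := by
      rw [hyz, op_succ_node_node, op_prec_node_node]
      simp only [map_add, star_join_right, op_succ_join_right, op_prec_join_right]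
      abel
    exact hl.trans ((by rw [h1, h2] : _ = _).trans hr.symm)
termination_by x.numNodes + y.numNodes + z.numNodes
decreasing_by all_goals simp only [numNodes]; omega

/-- In each law both sides carry the root of the same factor: the first, second and third
respectively. Comparing subtrees, the first and third laws reduce to associativity of `star`, and
the second needs nothing more. If a factor is `nil`, everything vanishes. -/
theorem op_laws_single (x y z : BinaryTree Unit →₀ 𝕜)
    (hx : ∃ t, x = single t 1) (hy : ∃ t, y = single t 1) (hz : ∃ t, z = single t 1) :
    op 𝕜 .succ (op 𝕜 .succ x y) z = op 𝕜 .succ x (op 𝕜 .succ y z + op 𝕜 .prec y z) ∧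
    op 𝕜 .succ (op 𝕜 .prec x y) z = op 𝕜 .prec x (op 𝕜 .succ y z) ∧
    op 𝕜 .prec x (op 𝕜 .prec y z) = op 𝕜 .prec (op 𝕜 .succ x y + op 𝕜 .prec x y) z := by
  obtain ⟨x, rfl⟩ := hx
  obtain ⟨y, rfl⟩ := hy
  obtain ⟨z, rfl⟩ := hz
  match x, y, z with
  | nil, _, _ => simp
  | node () _ _, nil, _ => simp
  | node _ _ _, node _ _ _, nil => simp
  | node () a b, node () c d, node () e f =>
    refine ⟨?_, ?_, ?_⟩
    · have h := star_assoc_single 𝕜 b (node () c d) (node () e f)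
      rw [op_succ_node_node, op_succ_join_left, h, star_node_node, op_succ_node_node 𝕜 c,
        op_prec_node_node 𝕜 c]
      simp only [map_add, op_succ_join_right]
    · rw [op_prec_node_node, op_succ_join_left, op_succ_node_node, op_prec_join_right]
    · have h := star_assoc_single 𝕜 (node () a b) (node () c d) e
      rw [op_prec_node_node 𝕜 c, op_prec_join_right, ← h, star_node_node, op_succ_node_node,
        op_prec_node_node]
      simp only [map_add, LinearMap.add_apply, op_prec_join_left]

theorem isNoncomZinbiel_op : IsNoncomZinbiel (op 𝕜) := by
  have h : ∀ x y z : BinaryTree Unit →₀ 𝕜,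
      op 𝕜 .succ (op 𝕜 .succ x y) z = op 𝕜 .succ x (op 𝕜 .succ y z + op 𝕜 .prec y z) ∧
      op 𝕜 .succ (op 𝕜 .prec x y) z = op 𝕜 .prec x (op 𝕜 .succ y z) ∧
      op 𝕜 .prec x (op 𝕜 .prec y z) = op 𝕜 .prec (op 𝕜 .succ x y + op 𝕜 .prec x y) z := by
    intro x y z
    induction x using Finsupp.induction_linear with
    | zero => simp
    | add f g hf hg =>
      simp only [map_add, LinearMap.add_apply] at hf hg ⊢
      rw [hf.1, hg.1, hf.2.1, hg.2.1, hf.2.2, hg.2.2]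
      exact ⟨by abel, by abel, by abel⟩
    | single s a =>
    induction y using Finsupp.induction_linear with
    | zero => simp
    | add f g hf hg =>
      simp only [map_add, LinearMap.add_apply] at hf hg ⊢
      rw [hf.1, hg.1, hf.2.1, hg.2.1, hf.2.2, hg.2.2]
      exact ⟨by abel, by abel, by abel⟩
    | single t b =>
    induction z using Finsupp.induction_linear with
    | zero => simp
    | add f g hf hg =>
      simp only [map_add, LinearMap.add_apply] at hf hg ⊢
      rw [hf.1, hg.1, hf.2.1, hg.2.1, hf.2.2, hg.2.2]
      exact ⟨by abel, by abel, by abel⟩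
    | single w c =>
      obtain ⟨h1, h2, h3⟩ := op_laws_single 𝕜 (single s 1) (single t 1) (single w 1)
        ⟨_, rfl⟩ ⟨_, rfl⟩ ⟨_, rfl⟩
      -- Scalars are pulled out so that the laws for basis trees apply.
      have hs (r : BinaryTree Unit) (k : 𝕜) : single r k = k • single r (1 : 𝕜) := by simp
      rw [hs s a, hs t b, hs w c]
      simp only [map_smul, LinearMap.smul_apply, ← smul_add, h1, h2, h3, and_self]
  exact ⟨fun x y z => (h x y z).1, fun x y z => (h x y z).2.1, fun x y z => (h x y z).2.2⟩

end LodayRonco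

/-! ### Evaluation of tree monomials in an algebra -/

namespace TreeMonomial

theorem arity_pos {L : Type} (t : TreeMonomial L) : 0 < t.arity := by
  induction t with
  | leaf => simp [arity]
  | node g l r _ _ => simp only [arity]; omega

variable {𝕜 : Type u} [Field 𝕜] {L : Type} {A : Type v} [AddCommGroup A] [Module 𝕜 A]
  (op : L → A →ₗ[𝕜] A →ₗ[𝕜] A)

/-- Evaluation of a tree monomial, with the input `x i` at the `i`-th leaf. -/
def eval : TreeMonomial L → (ℕ → A) → A
  | leaf, x => x 0
  | node g l r, x => op g (l.eval x) (r.eval fun i => x (i + l.arity))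

theorem eval_congr (t : TreeMonomial L) {x y : ℕ → A} (h : ∀ i < t.arity, x i = y i) :
    t.eval op x = t.eval op y := by
  induction t generalizing x y with
  | leaf => exact h 0 (by simp [arity])
  | node g l r ihl ihr =>
    simp only [arity] at h
    simp only [eval]
    rw [ihl fun i hi => h i (by omega), ihr fun i hi => h (i + l.arity) (by omega)]

/-- Along the path from the root to leaf `i`, each operation is linear in the branch containing that
leaf. The map `φ` depends on `s` only through its arity `n`, because this alone fixes the inputs
received by the leaves further right; hence one `φ` serves all combinations of monomials of arity
`n`. -/
theorem exists_eval_graft_eq_linear (t : TreeMonomial L) (i n : ℕ) (hi : i < t.arity)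
    (x : ℕ → A) : ∃ φ : A →ₗ[𝕜] A, ∀ s : TreeMonomial L, s.arity = n →
      (t.graft i s).eval op x = φ (s.eval op fun j => x (j + i)) := by
  induction t generalizing i x with
  | leaf =>
    have : i = 0 := by simpa [arity] using hi
    subst this
    exact ⟨LinearMap.id, fun s _ => rfl⟩
  | node g l r ihl ihr =>
    simp only [arity] at hi
    by_cases h : i < l.arity
    · obtain ⟨φ, hφ⟩ := ihl i h x
      refine ⟨(op g).flip (r.eval op fun j => x (j + (l.arity + n - 1))) ∘ₗ φ, fun s hs => ?_⟩
      have := arity_graft l i s h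
      have hn : (l.graft i s).arity = l.arity + n - 1 := by omega
      simp [graft, h, eval, hφ s hs, hn]
    · obtain ⟨φ, hφ⟩ := ihr (i - l.arity) (by omega) fun j => x (j + l.arity)
      refine ⟨op g (l.eval op x) ∘ₗ φ, fun s hs => ?_⟩
      have hj (j : ℕ) : j + (i - l.arity) + l.arity = j + i := by omega
      simp [graft, h, eval, hφ s hs, hj]

/-- Grafting is substitution: leaf `i` receives the value of `s`, and inputs to its right are
shifted by `s.arity - 1`. The truncated subtraction is harmless since arities are positive. -/
theorem eval_graft (t s : TreeMonomial L) (i : ℕ) (hi : i < t.arity) (x : ℕ → A) :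
    (t.graft i s).eval op x = t.eval op fun j =>
      if j < i then x j else if j = i then s.eval op (fun k => x (k + i))
        else x (j + s.arity - 1) := by
  have hs := s.arity_pos
  induction t generalizing i x with
  | leaf =>
    have : i = 0 := by simpa [arity] using hi
    subst this
    simp [graft, eval]
  | node g l r ihl ihr =>
    simp only [arity] at hi
    by_cases h : i < l.arity
    · simp only [graft, h, if_true, eval]
      rw [ihl i h x]
      congr 2
      funext j
      have := arity_graft l i s h
      rw [if_neg (by omega), if_neg (by omega)]
      congr 1
      omega
    · simp only [graft, h, if_false, eval]
      rw [ihr (i - l.arity) (by omega)]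
      congr 1
      · congr 1
        apply eval_congr
        intro j hj
        rw [if_pos (by omega)]
      · congr 1
        funext j
        have hk (k : ℕ) : k + (i - l.arity) + l.arity = k + i := by omega
        have h1 : j < i - l.arity ↔ j + l.arity < i := by omega
        have h2 : j = i - l.arity ↔ j + l.arity = i := by omega
        have h3 : j + s.arity - 1 + l.arity = j + l.arity + s.arity - 1 := by omega
        simp only [hk, h1, h2, h3]

/-- Linear extension of evaluation to linear combinations of tree monomials of given arity. -/
noncomputable def evalLinear (n : ℕ) (x : ℕ → A) : (OfArity L n →₀ 𝕜) →ₗ[𝕜] A :=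
  Finsupp.linearCombination 𝕜 fun t => t.1.eval op x

@[simp]
theorem evalLinear_single {n : ℕ} (x : ℕ → A) (t : OfArity L n) (c : 𝕜) :
    evalLinear op n x (Finsupp.single t c) = c • t.1.eval op x := by
  simp [evalLinear]

end TreeMonomial

/-! ### Identities of an algebra form an operadic ideal -/

namespace NSOperad

open TreeMonomial

variable {𝕜 : Type u} [Field 𝕜] {L : Type} {A : Type v} [AddCommGroup A] [Module 𝕜 A]
  (op : L → A →ₗ[𝕜] A →ₗ[𝕜] A)

theorem evalLinear_freeComp_single_right {m n r : ℕ} (i : ℕ) (hi : i < m) (h : r + 1 = m + n)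
    (a : OfArity L m →₀ 𝕜) (s : OfArity L n) (c : 𝕜) (x : ℕ → A) :
    evalLinear op r x (freeComp 𝕜 L i hi h a (Finsupp.single s c)) =
      c • evalLinear op m (fun j => if j < i then x j else if j = i then
        s.1.eval op (fun k => x (k + i)) else x (j + s.1.arity - 1)) a := by
  induction a using Finsupp.induction_linear with
  | zero => simp
  | add f g hf hg => simp only [map_add, LinearMap.add_apply, hf, hg, smul_add]
  | single t d =>
    rw [freeComp_single, evalLinear_single, evalLinear_single, smul_smul, mul_comm d c]
    congr 1
    exact eval_graft op t.1 s.1 i (by rw [t.2]; exact hi) x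

theorem exists_evalLinear_freeComp_single_left {m n r : ℕ} (i : ℕ) (hi : i < m)
    (h : r + 1 = m + n) (t : OfArity L m) (c : 𝕜) (x : ℕ → A) :
    ∃ φ : A →ₗ[𝕜] A, ∀ b : OfArity L n →₀ 𝕜,
      evalLinear op r x (freeComp 𝕜 L i hi h (Finsupp.single t c) b) =
        φ (evalLinear op n (fun j => x (j + i)) b) := by
  obtain ⟨φ, hφ⟩ := exists_eval_graft_eq_linear op t.1 i n (by rw [t.2]; exact hi) x
  refine ⟨c • φ, fun b => ?_⟩
  induction b using Finsupp.induction_linear with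
  | zero => simp
  | add f g hf hg => simp only [map_add, hf, hg]
  | single s d =>
    rw [freeComp_single, evalLinear_single, evalLinear_single, map_smul, LinearMap.smul_apply,
      smul_smul, mul_comm d c]
    congr 1
    exact hφ s.1 s.2

/-- Inserting a monomial into `a` evaluates `a` at modified inputs, which is why `a` must vanish at
all inputs and not only at `x`. -/
theorem evalLinear_freeComp_eq_zero_left {m n r : ℕ} (i : ℕ) (hi : i < m) (h : r + 1 = m + n)
    (a : OfArity L m →₀ 𝕜) (b : OfArity L n →₀ 𝕜) (ha : ∀ x, evalLinear op m x a = 0)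
    (x : ℕ → A) : evalLinear op r x (freeComp 𝕜 L i hi h a b) = 0 := by
  induction b using Finsupp.induction_linear with
  | zero => simp
  | add f g hf hg => rw [map_add, map_add, hf, hg, add_zero]
  | single s c => rw [evalLinear_freeComp_single_right, ha, smul_zero]

theorem evalLinear_freeComp_eq_zero_right {m n r : ℕ} (i : ℕ) (hi : i < m) (h : r + 1 = m + n)
    (a : OfArity L m →₀ 𝕜) (b : OfArity L n →₀ 𝕜) (hb : ∀ x, evalLinear op n x b = 0)
    (x : ℕ → A) : evalLinear op r x (freeComp 𝕜 L i hi h a b) = 0 := by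
  induction a using Finsupp.induction_linear with
  | zero => simp
  | add f g hf hg => rw [map_add, LinearMap.add_apply, map_add, hf, hg, add_zero]
  | single t c =>
    obtain ⟨φ, hφ⟩ := exists_evalLinear_freeComp_single_left op i hi h t c x
    rw [hφ, hb, map_zero]

/-- The operadic ideal of the identities satisfied by a family of bilinear operations. -/
noncomputable def identities : OperadIdeal (free 𝕜 L) where
  carrier n := ⨅ x : ℕ → A, LinearMap.ker (evalLinear op n x)
  comp_mem_left i hi h a b ha :=
    (Submodule.mem_iInf _).2 (evalLinear_freeComp_eq_zero_left op i hi h a b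
      ((Submodule.mem_iInf _).1 ha))
  comp_mem_right i hi h a b hb :=
    (Submodule.mem_iInf _).2 (evalLinear_freeComp_eq_zero_right op i hi h a b
      ((Submodule.mem_iInf _).1 hb))

theorem leftComb_eq (f g : L) : free.leftComb 𝕜 f g =
    Finsupp.single (⟨node f (node g leaf leaf) leaf, rfl⟩ : OfArity L 3) 1 := by
  refine (freeComp_single ..).trans ?_
  rw [mul_one]
  rfl

theorem rightComb_eq (f g : L) : free.rightComb 𝕜 f g =
    Finsupp.single (⟨node f leaf (node g leaf leaf), rfl⟩ : OfArity L 3) 1 := by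
  refine (freeComp_single ..).trans ?_
  rw [mul_one]
  rfl

/-- This makes `identities op` one of the ideals whose intersection is the generated ideal, so
evaluation factors through the quotient. -/
theorem zinRelations_subset_identities {op : ZinGen → A →ₗ[𝕜] A →ₗ[𝕜] A}
    (h : IsNoncomZinbiel op) (n : ℕ) : zinRelations 𝕜 n ⊆ (identities op).carrier n := by
  intro a ha
  match n with
  | 0 | 1 | 2 | n + 4 => simp [zinRelations] at ha
  | 3 =>
    refine (Submodule.mem_iInf _).2 fun x => LinearMap.mem_ker.2 ?_
    have key (a b c : OfArity ZinGen 3)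
        (habc : a.1.eval op x = b.1.eval op x + c.1.eval op x) : evalLinear op 3 x
          (Finsupp.single a (1 : 𝕜) - Finsupp.single b (1 : 𝕜) - Finsupp.single c (1 : 𝕜)) = 0 := by
      simp [habc]
    have key' (a b : OfArity ZinGen 3) (hab : a.1.eval op x = b.1.eval op x) :
        evalLinear op 3 x (Finsupp.single a (1 : 𝕜) - Finsupp.single b (1 : 𝕜)) = 0 := by
      simp [hab]
    rcases ha with rfl | rfl | rfl
    · rw [leftComb_eq, rightComb_eq, rightComb_eq]
      exact key _ _ _ (by simp [eval, arity, h.succ_succ])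
    · rw [leftComb_eq, rightComb_eq]
      exact key' _ _ (by simp [eval, arity, h.prec_succ])
    · rw [leftComb_eq, leftComb_eq, rightComb_eq]
      exact key _ _ _ (by simp [eval, arity, h.prec_prec])

/-- Evaluation at given inputs, on the components of the nonsymmetric Zinbiel operad. -/
noncomputable def zinEval {op : ZinGen → A →ₗ[𝕜] A →ₗ[𝕜] A} (h : IsNoncomZinbiel op) (n : ℕ)
    (x : ℕ → A) : (noncomZin 𝕜).Op n →ₗ[𝕜] A :=
  Submodule.liftQ (((free 𝕜 ZinGen).idealSpan (zinRelations 𝕜)).carrier n)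
    (evalLinear op n x) fun _ ha =>
      (Submodule.mem_iInf _).1 ((Submodule.mem_iInf _).1 ha
        ⟨identities op, zinRelations_subset_identities h⟩) x

end NSOperad

/-! ### The relations with arbitrary monomials substituted -/

namespace NSOperad

open TreeMonomial

variable (𝕜 : Type u) [Field 𝕜]

/-- The projection from the free operad to the nonsymmetric Zinbiel operad. -/
noncomputable def zinQuot (n : ℕ) : (free 𝕜 ZinGen).Op n →ₗ[𝕜] (noncomZin 𝕜).Op n :=
  (((free 𝕜 ZinGen).idealSpan (zinRelations 𝕜)).carrier n).mkQ

theorem zinQuot_eq_zero {n : ℕ} {a : (free 𝕜 ZinGen).Op n} (ha : a ∈ zinRelations 𝕜 n) :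
    zinQuot 𝕜 n a = 0 :=
  (Submodule.Quotient.mk_eq_zero _).2 ((Submodule.mem_iInf _).2 fun J => J.2 n ha)

/-- The class of a tree monomial in the nonsymmetric Zinbiel operad. -/
noncomputable def zinClass {n : ℕ} (t : TreeMonomial ZinGen) (h : t.arity = n) :
    (noncomZin 𝕜).Op n :=
  zinQuot 𝕜 n (Finsupp.single (⟨t, h⟩ : OfArity ZinGen n) (1 : 𝕜))

theorem eq_top_of_zinClass_mem {n : ℕ} {p : Submodule 𝕜 ((noncomZin 𝕜).Op n)}
    (h : ∀ t ht, zinClass 𝕜 t ht ∈ p) : p = ⊤ := by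
  have key : ∀ a : OfArity ZinGen n →₀ 𝕜, zinQuot 𝕜 n a ∈ p := by
    intro a
    induction a using Finsupp.induction_linear with
    | zero => exact (map_zero (zinQuot 𝕜 n)).symm ▸ p.zero_mem
    | add f g hf hg => exact (map_add (zinQuot 𝕜 n) f g).symm ▸ p.add_mem hf hg
    | single t c =>
      have ht : (Finsupp.single t c : OfArity ZinGen n →₀ 𝕜) = c • Finsupp.single t 1 := by simp
      rw [ht]
      exact (map_smul (zinQuot 𝕜 n) c _).symm ▸ p.smul_mem c (h t.1 t.2)
  rw [eq_top_iff]
  intro x _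
  obtain ⟨a, rfl⟩ := Submodule.Quotient.mk_surjective _ x
  exact key a

theorem arity_graft_of_arity {L : Type} {m n r : ℕ} (i : ℕ) (hi : i < m) (h : r + 1 = m + n)
    {t s : TreeMonomial L} (ht : t.arity = m) (hs : s.arity = n) : (t.graft i s).arity = r := by
  have := arity_graft t i s (by omega)
  omega

theorem comp_zinClass {m n r : ℕ} (i : ℕ) (hi : i < m) (h : r + 1 = m + n)
    (t s : TreeMonomial ZinGen) (ht : t.arity = m) (hs : s.arity = n) :
    (noncomZin 𝕜).comp i hi h (zinClass 𝕜 t ht) (zinClass 𝕜 s hs) =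
      zinClass 𝕜 (t.graft i s) (arity_graft_of_arity i hi h ht hs) := by
  refine (quotientComp_mk _ _ i hi h _ _).trans (congrArg (zinQuot 𝕜 r) ?_)
  refine (freeComp_single ..).trans ?_
  rw [mul_one]
  rfl

theorem arity_corolla (g : ZinGen) : (node g leaf leaf).arity = 2 := rfl

theorem arity_leftComb (f g : ZinGen) : (node f (node g leaf leaf) leaf).arity = 3 := rfl

theorem arity_rightComb (f g : ZinGen) : (node f leaf (node g leaf leaf)).arity = 3 := rfl

theorem zinQuot_leftComb (f g : ZinGen) : zinQuot 𝕜 3 (free.leftComb 𝕜 f g) =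
    zinClass 𝕜 (node f (node g leaf leaf) leaf) (arity_leftComb f g) :=
  congrArg _ (leftComb_eq f g)

theorem zinQuot_rightComb (f g : ZinGen) : zinQuot 𝕜 3 (free.rightComb 𝕜 f g) =
    zinClass 𝕜 (node f leaf (node g leaf leaf)) (arity_rightComb f g) :=
  congrArg _ (rightComb_eq f g)

/-- Substitution of three tree monomials in the elements of arity three. -/
theorem exists_linear_graft_three {r : ℕ} (a b c : TreeMonomial ZinGen)
    (h : a.arity + b.arity + c.arity = r) :
    ∃ φ : (free 𝕜 ZinGen).Op 3 →ₗ[𝕜] (noncomZin 𝕜).Op r,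
      (∀ ρ ∈ zinRelations 𝕜 3, φ ρ = 0) ∧
      (∀ f g, φ (free.leftComb 𝕜 f g) = zinClass 𝕜 (node f (node g a b) c) h) ∧
      (∀ f g, φ (free.rightComb 𝕜 f g) =
        zinClass 𝕜 (node f a (node g b c)) (by simp only [arity]; omega)) := by
  -- The insertions run from right to left, `c` first, so that the positions of the remaining leaves
  -- do not move.
  refine ⟨((noncomZin 𝕜).comp 0 (by omega : 0 < 1 + b.arity + c.arity) (by omega)).flip
      (zinClass 𝕜 a rfl) ∘ₗ
    ((noncomZin 𝕜).comp 1 (by omega : 1 < 2 + c.arity) (by omega)).flip (zinClass 𝕜 b rfl) ∘ₗ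
    ((noncomZin 𝕜).comp 2 (by omega) (by omega)).flip (zinClass 𝕜 c rfl) ∘ₗ zinQuot 𝕜 3, ?_, ?_, ?_⟩
  · intro ρ hρ
    simp only [LinearMap.comp_apply, zinQuot_eq_zero 𝕜 hρ, map_zero]
  all_goals
    intro f g
    simp only [LinearMap.comp_apply, LinearMap.flip_apply, zinQuot_leftComb, zinQuot_rightComb,
      comp_zinClass]
    congr 1 <;> simp [TreeMonomial.graft, arity]

theorem zinClass_succ_succ {r : ℕ} (a b c : TreeMonomial ZinGen)
    (h : a.arity + b.arity + c.arity = r) :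
    zinClass 𝕜 (node .succ (node .succ a b) c) h =
      zinClass 𝕜 (node .succ a (node .succ b c)) (by simp only [arity]; omega) +
      zinClass 𝕜 (node .succ a (node .prec b c)) (by simp only [arity]; omega) := by
  obtain ⟨φ, h0, hl, hr⟩ := exists_linear_graft_three 𝕜 a b c h
  have := h0 _ (Or.inl rfl)
  rwa [map_sub, map_sub, hl, hr, hr, sub_sub, sub_eq_zero] at this

theorem zinClass_prec_succ {r : ℕ} (a b c : TreeMonomial ZinGen)
    (h : a.arity + b.arity + c.arity = r) :
    zinClass 𝕜 (node .succ (node .prec a b) c) h =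
      zinClass 𝕜 (node .prec a (node .succ b c)) (by simp only [arity]; omega) := by
  obtain ⟨φ, h0, hl, hr⟩ := exists_linear_graft_three 𝕜 a b c h
  have := h0 _ (Or.inr (Or.inl rfl))
  rwa [map_sub, hl, hr, sub_eq_zero] at this

theorem zinClass_prec_prec {r : ℕ} (a b c : TreeMonomial ZinGen)
    (h : a.arity + b.arity + c.arity = r) :
    zinClass 𝕜 (node .prec a (node .prec b c)) (by simp only [arity]; omega) =
      zinClass 𝕜 (node .prec (node .succ a b) c) h +
      zinClass 𝕜 (node .prec (node .prec a b) c) h := by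
  obtain ⟨φ, h0, hl, hr⟩ := exists_linear_graft_three 𝕜 a b c h
  have := h0 _ (Or.inr (Or.inr rfl))
  rwa [map_sub, map_sub, hl, hl, hr, sub_sub, sub_eq_zero] at this

/-- The product of two elements of the operad under a generating operation. -/
noncomputable def zinMul (g : ZinGen) {m n r : ℕ} (h : m + n = r) :
    (noncomZin 𝕜).Op m →ₗ[𝕜] (noncomZin 𝕜).Op n →ₗ[𝕜] (noncomZin 𝕜).Op r :=
  -- Once the first factor fills input `0`, the second input of the corolla has index `m`.
  (noncomZin 𝕜).comp m m.lt_succ_self (by omega) ∘ₗ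
    (noncomZin 𝕜).comp 0 two_pos (by omega) (zinClass 𝕜 (node g leaf leaf) (arity_corolla g))

theorem zinMul_zinClass (g : ZinGen) {m n r : ℕ} (h : m + n = r) (s t : TreeMonomial ZinGen)
    (hs : s.arity = m) (ht : t.arity = n) :
    zinMul 𝕜 g h (zinClass 𝕜 s hs) (zinClass 𝕜 t ht) =
      zinClass 𝕜 (node g s t) (by rw [arity, hs, ht, h]) := by
  simp only [zinMul, LinearMap.comp_apply, comp_zinClass]
  congr 1
  simp [TreeMonomial.graft, arity, hs]

end NSOperad

/-! ### Normal forms indexed by planar binary trees -/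

namespace BinaryTree

open TreeMonomial

/-- The normal form `(l ≺ x) ≻ r` of the tree monomials, indexed by nonempty planar binary trees,
where the operations with an empty factor are omitted. -/
def normalForm : BinaryTree Unit → TreeMonomial ZinGen
  | nil => leaf
  | node _ nil nil => leaf
  | node _ (node _ a b) nil => .node .prec (normalForm (node () a b)) leaf
  | node _ nil (node _ c d) => .node .succ leaf (normalForm (node () c d))
  | node _ (node _ a b) (node _ c d) =>
    .node .succ (.node .prec (normalForm (node () a b)) leaf) (normalForm (node () c d))

theorem normalForm_node_node (a c d : BinaryTree Unit) :
    normalForm (node () a (node () c d)) =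
      .node .succ (normalForm (node () a nil)) (normalForm (node () c d)) := by
  cases a <;> simp [normalForm]

theorem arity_normalForm (t : BinaryTree Unit) (ht : t ≠ nil) :
    (normalForm t).arity = t.numNodes := by
  induction t with
  | nil => exact absurd rfl ht
  | node _ l r ihl ihr =>
    cases l <;> cases r <;> simp_all [normalForm, arity] <;> omega

/-- With `Y` the one-node tree, `l ≺ Y` is the tree with left subtree `l` and empty right subtree,
and applying `≻ r` to it fills in `r`. The inputs are constant, so index shifts play no role. -/
theorem eval_normalForm (𝕜 : Type u) [Field 𝕜] (t : BinaryTree Unit) (ht : t ≠ nil) :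
    (normalForm t).eval (LodayRonco.op 𝕜) (fun _ => Finsupp.single (node () nil nil) 1) =
      Finsupp.single t 1 := by
  induction t with
  | nil => exact absurd rfl ht
  | node _ l r ihl ihr =>
    rcases l with _ | ⟨⟨⟩, _, _⟩ <;> rcases r with _ | ⟨⟨⟩, _, _⟩ <;>
      simp_all [normalForm, eval, LodayRonco.op_succ_node_node, LodayRonco.op_prec_node_node]

end BinaryTree

/-! ### Normal forms span, and form a basis -/

namespace NSOperad

open TreeMonomial BinaryTree

variable (𝕜 : Type u) [Field 𝕜]

/-- The span of the classes of the tree monomials satisfying a predicate. -/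
noncomputable def zinSpan (p : TreeMonomial ZinGen → Prop) (n : ℕ) : Submodule 𝕜 ((noncomZin 𝕜).Op n) :=
  Submodule.span 𝕜 {x | ∃ t ht, p t ∧ zinClass 𝕜 t ht = x}

theorem zinMul_mem_zinSpan {p q w : TreeMonomial ZinGen → Prop} (g : ZinGen)
    (hpq : ∀ s t, p s → q t → w (.node g s t)) {m n r : ℕ} (h : m + n = r)
    {x : (noncomZin 𝕜).Op m} {y : (noncomZin 𝕜).Op n} (hx : x ∈ zinSpan 𝕜 p m)
    (hy : y ∈ zinSpan 𝕜 q n) : zinMul 𝕜 g h x y ∈ zinSpan 𝕜 w r := by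
  have := Submodule.apply_mem_map₂ (zinMul 𝕜 g h) hx hy
  rw [zinSpan, zinSpan, Submodule.map₂_span_span] at this
  refine Submodule.span_mono ?_ this
  rintro _ ⟨_, ⟨s, _, hs, rfl⟩, _, ⟨t, _, ht, rfl⟩, rfl⟩
  exact ⟨_, _, hpq _ _ hs ht, (zinMul_zinClass 𝕜 g h s t _ _).symm⟩

theorem zinClass_mem_zinSpan {p : TreeMonomial ZinGen → Prop} {n : ℕ} {t : TreeMonomial ZinGen}
    {h : t.arity = n} (ht : p t) : zinClass 𝕜 t h ∈ zinSpan 𝕜 p n :=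
  Submodule.subset_span ⟨t, h, ht, rfl⟩

/-- Being the normal form of a nonempty planar binary tree. -/
def IsNormalForm (t : TreeMonomial ZinGen) : Prop := ∃ a b, normalForm (node () a b) = t

/-- Being the normal form of a planar binary tree with empty right subtree. -/
def IsLeftNormalForm (t : TreeMonomial ZinGen) : Prop := ∃ a, normalForm (node () a nil) = t

theorem IsLeftNormalForm.isNormalForm {t : TreeMonomial ZinGen} (h : IsLeftNormalForm t) :
    IsNormalForm t := h.imp fun _ h => ⟨nil, h⟩

theorem IsLeftNormalForm.node_succ {s t : TreeMonomial ZinGen} (hs : IsLeftNormalForm s)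
    (ht : IsNormalForm t) : IsNormalForm (.node .succ s t) := by
  obtain ⟨a, rfl⟩ := hs
  obtain ⟨c, d, rfl⟩ := ht
  exact ⟨a, node () c d, normalForm_node_node a c d⟩

theorem isLeftNormalForm_leaf : IsLeftNormalForm leaf := ⟨nil, by simp [normalForm]⟩

theorem IsNormalForm.node_prec_leaf {s : TreeMonomial ZinGen} (hs : IsNormalForm s) :
    IsLeftNormalForm (.node .prec s leaf) := by
  obtain ⟨a, b, rfl⟩ := hs
  exact ⟨node () a b, by simp [normalForm]⟩

theorem IsNormalForm.cases {t : TreeMonomial ZinGen} (h : IsNormalForm t) :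
    IsLeftNormalForm t ∨ ∃ s w, IsLeftNormalForm s ∧ IsNormalForm w ∧ t = .node .succ s w := by
  obtain ⟨a, b, rfl⟩ := h
  cases b with
  | nil => exact Or.inl ⟨a, rfl⟩
  | node _ c d =>
    exact Or.inr ⟨_, _, ⟨a, rfl⟩, ⟨c, d, rfl⟩, normalForm_node_node a c d⟩

theorem IsLeftNormalForm.cases {t : TreeMonomial ZinGen} (h : IsLeftNormalForm t) :
    t = leaf ∨ ∃ s, IsNormalForm s ∧ t = .node .prec s leaf := by
  obtain ⟨a, rfl⟩ := h
  cases a with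
  | nil => exact Or.inl (by simp [normalForm])
  | node _ c d => exact Or.inr ⟨_, ⟨c, d, rfl⟩, by simp [normalForm]⟩

theorem zinSpan_left_le (n : ℕ) : zinSpan 𝕜 IsLeftNormalForm n ≤ zinSpan 𝕜 IsNormalForm n :=
  Submodule.span_mono fun _ ⟨t, h, ht, hx⟩ => ⟨t, h, ht.isNormalForm, hx⟩

/-- Induction on total arity. If `s = v ≻ w`, the first relation moves the product to `w` and `t`.
If `t = v ≻ w`, the second turns `s ≺ t` into `(s ≺ v) ≻ w`. If `t = w ≺ x`, the third leaves `(s ≻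
w) ≺ x` and `(s ≺ w) ≺ x`. -/
theorem zinClass_node_normalForm_mem (s t : TreeMonomial ZinGen) (hs : IsNormalForm s)
    (ht : IsNormalForm t) (g : ZinGen) {r : ℕ} (h : s.arity + t.arity = r) :
    zinClass 𝕜 (.node g s t) h ∈ zinSpan 𝕜 IsNormalForm r := by
  induction r using Nat.strong_induction_on generalizing s t g with
  | _ r ih =>
  have succ_mem (v w : TreeMonomial ZinGen) (h : v.arity + w.arity = r)
      (hv : zinClass 𝕜 v rfl ∈ zinSpan 𝕜 IsLeftNormalForm v.arity)
      (hw : zinClass 𝕜 w rfl ∈ zinSpan 𝕜 IsNormalForm w.arity) :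
      zinClass 𝕜 (.node .succ v w) h ∈ zinSpan 𝕜 IsNormalForm r := by
    rw [← zinMul_zinClass 𝕜 .succ h v w rfl rfl]
    exact zinMul_mem_zinSpan 𝕜 .succ (fun _ _ hs ht => hs.node_succ ht) h hv hw
  have prec_leaf_mem (w : TreeMonomial ZinGen) {k : ℕ} (h : w.arity + 1 = k)
      (hw : zinClass 𝕜 w rfl ∈ zinSpan 𝕜 IsNormalForm w.arity) :
      zinClass 𝕜 (.node .prec w leaf) h ∈ zinSpan 𝕜 IsLeftNormalForm k := by
    rw [← zinMul_zinClass 𝕜 .prec h w leaf rfl rfl]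
    exact zinMul_mem_zinSpan (p := IsNormalForm) (q := (· = leaf)) 𝕜 .prec
      (fun s t hs ht => by subst ht; exact hs.node_prec_leaf) h hw
      (zinClass_mem_zinSpan 𝕜 rfl)
  cases g with
  | succ =>
    obtain hs' | ⟨v, w, hv, hw, rfl⟩ := hs.cases
    · exact zinClass_mem_zinSpan 𝕜 (hs'.node_succ ht)
    · have := v.arity_pos
      simp only [arity] at h
      rw [zinClass_succ_succ 𝕜 v w t h]
      exact add_mem
        (succ_mem v _ _ (zinClass_mem_zinSpan 𝕜 hv)
          (ih (w.arity + t.arity) (by omega) w t hw ht .succ rfl))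
        (succ_mem v _ _ (zinClass_mem_zinSpan 𝕜 hv)
          (ih (w.arity + t.arity) (by omega) w t hw ht .prec rfl))
  | prec =>
    -- The sharper conclusion, a combination of left normal forms, is what allows `≻ w` to be
    -- applied afterwards. The bound `k ≤ r` suffices because the third relation strips one leaf
    -- before the induction hypothesis is used.
    have left (v : TreeMonomial ZinGen) (hv : IsLeftNormalForm v) {k : ℕ}
        (hk : s.arity + v.arity = k) (hkr : k ≤ r) :
        zinClass 𝕜 (.node .prec s v) hk ∈ zinSpan 𝕜 IsLeftNormalForm k := by
      obtain rfl | ⟨w, hw, rfl⟩ := hv.cases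
      · exact zinClass_mem_zinSpan 𝕜 hs.node_prec_leaf
      · simp only [arity] at hk
        rw [zinClass_prec_prec 𝕜 s w leaf (by simp only [arity]; omega)]
        exact add_mem
          (prec_leaf_mem _ _ (ih (s.arity + w.arity) (by omega) s w hs hw .succ rfl))
          (prec_leaf_mem _ _ (ih (s.arity + w.arity) (by omega) s w hs hw .prec rfl))
    obtain ht' | ⟨v, w, hv, hw, rfl⟩ := ht.cases
    · exact zinSpan_left_le 𝕜 _ (left t ht' h le_rfl)
    · simp only [arity] at h
      rw [← zinClass_prec_succ 𝕜 s v w (by omega)]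
      exact succ_mem _ w _ (left v hv rfl (by omega)) (zinClass_mem_zinSpan 𝕜 hw)

/-- By bilinearity of `zinMul`, expanding both subtrees in normal forms reduces the claim to a
product of two normal forms. -/
theorem zinClass_mem_zinSpan_isNormalForm (t : TreeMonomial ZinGen) {n : ℕ} (h : t.arity = n) :
    zinClass 𝕜 t h ∈ zinSpan 𝕜 IsNormalForm n := by
  induction t generalizing n with
  | leaf => exact zinClass_mem_zinSpan 𝕜 isLeftNormalForm_leaf.isNormalForm
  | node g l r ihl ihr =>
    simp only [arity] at h
    have hm := Submodule.apply_mem_map₂ (zinMul 𝕜 g h) (ihl rfl) (ihr rfl)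
    rw [zinSpan, zinSpan, Submodule.map₂_span_span, zinMul_zinClass] at hm
    refine Submodule.span_le.2 ?_ hm
    rintro _ ⟨_, ⟨s, hs', hs, rfl⟩, _, ⟨t, ht', ht, rfl⟩, rfl⟩
    change zinMul 𝕜 g h _ _ ∈ zinSpan 𝕜 IsNormalForm n
    rw [zinMul_zinClass]
    exact zinClass_node_normalForm_mem 𝕜 s t hs ht g _

theorem zinSpan_isNormalForm (n : ℕ) : zinSpan 𝕜 IsNormalForm n = ⊤ :=
  eq_top_of_zinClass_mem 𝕜 fun t ht => zinClass_mem_zinSpan_isNormalForm 𝕜 t ht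

theorem zinEval_zinClass {A : Type v} [AddCommGroup A] [Module 𝕜 A]
    {op : ZinGen → A →ₗ[𝕜] A →ₗ[𝕜] A} (h : IsNoncomZinbiel op) {n : ℕ} (x : ℕ → A)
    (t : TreeMonomial ZinGen) (ht : t.arity = n) :
    zinEval h n x (zinClass 𝕜 t ht) = t.eval op x :=
  (evalLinear_single op x (⟨t, ht⟩ : OfArity ZinGen n) 1).trans (one_smul _ _)

/-- The classes of the normal forms form a basis of the components of the operad. -/
noncomputable def zinBasis {n : ℕ} (hn : 1 ≤ n) :
    Module.Basis (treesOfNumNodesEq n) 𝕜 ((noncomZin 𝕜).Op n) :=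
  have hne (T : treesOfNumNodesEq n) : T.1 ≠ nil := by
    intro h
    have := mem_treesOfNumNodesEq.1 T.2
    rw [h, numNodes] at this
    omega
  let e (T : treesOfNumNodesEq n) : (noncomZin 𝕜).Op n :=
    zinClass 𝕜 (normalForm T.1)
      ((arity_normalForm T.1 (hne T)).trans (mem_treesOfNumNodesEq.1 T.2))
  Module.Basis.mk (v := e)
    (by
      let ev := zinEval (LodayRonco.isNoncomZinbiel_op 𝕜) n
        fun _ => Finsupp.single (node () nil nil) 1
      -- Evaluation sends the candidate basis to distinct basis vectors, which forces independence.
      have hev : ev ∘ e = fun T => Finsupp.single T.1 1 := by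
        funext T
        refine (zinEval_zinClass 𝕜 _ _ _ _).trans ?_
        exact eval_normalForm 𝕜 T.1 (hne T)
      refine LinearIndependent.of_comp ev ?_
      rw [hev]
      have := (Finsupp.basisSingleOne (R := 𝕜) (ι := BinaryTree Unit)).linearIndependent.comp
        (fun T : treesOfNumNodesEq n => T.1) Subtype.val_injective
      simpa [Function.comp_def] using this)
    (by
      rw [← zinSpan_isNormalForm, zinSpan, Submodule.span_le]
      rintro _ ⟨_, ht, ⟨a, b, rfl⟩, rfl⟩
      refine Submodule.subset_span ⟨⟨node () a b, mem_treesOfNumNodesEq.2 ?_⟩, rfl⟩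
      rw [← arity_normalForm _ (by simp), ht])

end NSOperad

/-! ### Dimension count -/

theorem mainTheorem5 (𝕜 : Type u) [Field 𝕜] (n : ℕ) (hn : 1 ≤ n) :
    Module.Finite 𝕜 ((noncomZin 𝕜).Op n) ∧
      Module.finrank 𝕜 ((noncomZin 𝕜).Op n) = catalan n ∧
      (Module.finrank 𝕜 ((noncomZin 𝕜).Op n) : ℚ) =
        (Nat.factorial (2 * n) : ℚ) / ((Nat.factorial n : ℚ) * (Nat.factorial (n + 1) : ℚ)) := by
  have hb : Module.finrank 𝕜 ((noncomZin 𝕜).Op n) = catalan n := by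
    rw [Module.finrank_eq_card_basis (NSOperad.zinBasis 𝕜 hn), Fintype.card_coe,
      BinaryTree.treesOfNumNodesEq_card_eq_catalan]
  refine ⟨Module.Finite.of_basis (NSOperad.zinBasis 𝕜 hn), hb, ?_⟩
  -- The factorial formula follows from the central binomial coefficient; working over `ℚ` makes the
  -- division exact.
  have h1 : ((n : ℚ) + 1) * catalan n = Nat.centralBinom n := by
    exact_mod_cast succ_mul_catalan_eq_centralBinom n
  have h2 : (Nat.centralBinom n : ℚ) =
      (Nat.factorial (2 * n) : ℚ) / ((Nat.factorial n : ℚ) * (Nat.factorial n : ℚ)) := by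
    rw [Nat.centralBinom_eq_two_mul_choose, Nat.cast_choose ℚ (by omega : n ≤ 2 * n),
      show 2 * n - n = n by omega]
  have h3 : (n : ℚ) + 1 ≠ 0 := by positivity
  have h4 : (Nat.factorial n : ℚ) ≠ 0 := by positivity
  rw [hb, Nat.factorial_succ]
  push_cast
  rw [h2] at h1
  field_simp at h1 ⊢
  linear_combination h1
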